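/- Let $X$ be a locally convex Hausdorff topological vector space over $\mathbb{C}$. Call $X$ injective in the category $\mathcal{LCS}$ of locally convex Hausdorff topological vector spaces over $\mathbb{C}$ and continuous linear maps if, for every object $B$ of $\mathcal{LCS}$ and every linear subspace $A \subseteq B$ (with the subspace topology), each continuous linear map $f \colon A \to X$ extends to a continuous linear map $g \colon B \to X$. The following conditions are equivalent: (1) $X$ is an injective object of the category $\mathcal{LCS}$. (2) There are a set $T$, sets $J_{t_n}$ ($t \in T$, $n \in \omega$), and, for each $t \in T$, a complemented subspace $F_t$ of the product $\prod\{\ell_\infty(J_{t_n}) \colon n \in \omega\}$ (that is, a linear subspace which is the image of a continuous linear projection) such that $X$ is isomorphic, as a topological vector space, to the product $\prod\{F_t \colon t \in T\}$. Here $\ell_\infty(J)$ is the Banach space of bounded complex families indexed by $J$ with the supremum norm, and products carry the product topology. -/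

import Mathlib

universe u

open scoped ENNReal

/-- The complex Banach space `ℓ_∞(J)` of bounded families `(x_j)_{j ∈ J}` of complex numbers,
with the supremum norm. -/
abbrev EllInfty (J : Type u) : Type u := lp (fun _ : J => ℂ) ∞

/-- A complex topological vector space `X` is injective in the category of locally convex
Hausdorff complex topological vector spaces and continuous linear maps: every continuous linear
map into `X` defined on a (not necessarily closed) linear subspace `A`, with the subspace
topology, of a locally convex Hausdorff space `B` extends to a continuous linear map on `B`. -/
def IsInjectiveLCS (X : Type u) [AddCommGroup X] [Module ℂ X] [TopologicalSpace X] : Prop :=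
  ∀ (B : Type u) [AddCommGroup B] [Module ℂ B] [TopologicalSpace B] [IsTopologicalAddGroup B]
    [ContinuousSMul ℂ B] [LocallyConvexSpace ℝ B] [T2Space B]
    (A : Submodule ℂ B) (f : A →L[ℂ] X),
    ∃ g : B →L[ℂ] X, ∀ a : A, g (a : B) = f a

/-!
By Hahn–Banach the spaces `ℓ_∞(J)` are injective, and every locally convex Hausdorff space embeds in
a product of them; so the injective spaces are the retracts of the products `∏ i, ℓ_∞(J i)`. Let
`P` be the idempotent of such a product whose range is `X`. As the factors are normed, each
coordinate of `P x` depends on finitely many coordinates of `x`. Well-order the index set and let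
the rank of `i` be the least index having a coordinate that depends, through a finite chain, on the
`i`-th. Only countably many indices share a rank, and coordinates depend only on those of lower or
equal rank, so `P` is block triangular for the grouping of the factors by rank. A strictly
triangular perturbation of the identity is invertible by well-founded recursion, which makes `P`
similar to its diagonal; hence `X` is isomorphic to the product of the ranges of the diagonal
blocks, and these are complemented in countable products.
-/

open Topology

section BlockOperators

variable {R ι : Type*} {G : ι → Type*} [Ring R] [∀ a, AddCommGroup (G a)] [∀ a, Module R (G a)]
  [∀ a, TopologicalSpace (G a)] {r : ι → ι → Prop} {S T : (∀ a, G a) →L[R] (∀ a, G a)}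

/-- The block matrix of the operator `T` on `∏ G a` is supported on the relation `r`: the
coordinate of `T x` at `a` depends only on the coordinates of `x` at those `b` with `r b a`. By
linearity it is enough to say this for the value zero. -/
def IsSupportedOn (r : ι → ι → Prop) (T : (∀ a, G a) →L[R] (∀ a, G a)) : Prop :=
  ∀ x a, (∀ b, r b a → x b = 0) → T x a = 0

namespace IsSupportedOn

theorem apply_congr (hT : IsSupportedOn r T) {x y : ∀ a, G a} {a : ι}
    (h : ∀ b, r b a → x b = y b) : T x a = T y a := by
  rw [← sub_eq_zero, ← Pi.sub_apply, ← map_sub]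
  exact hT _ _ fun b hb => sub_eq_zero.2 (h b hb)

theorem mul {r₁ r₂ : ι → ι → Prop} (hS : IsSupportedOn r₁ S) (hT : IsSupportedOn r₂ T)
    (h : ∀ a b c, r₁ b a → r₂ c b → r c a) : IsSupportedOn r (S * T) :=
  fun x a hx => hS _ _ fun b hb => hT x b fun c hc => hx c (h a b c hb hc)

end IsSupportedOn

theorem isSupportedOn_piMap (f : ∀ a, G a →L[R] G a) :
    IsSupportedOn (· = ·) (ContinuousLinearMap.piMap f) :=
  fun x a hx => by simp [hx a rfl]

section Diagonal

variable [DecidableEq ι]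

/-- The diagonal entry at `a` of the block matrix of an operator on `∏ G a`. -/
def diagonalBlock (T : (∀ a, G a) →L[R] (∀ a, G a)) (a : ι) : G a →L[R] G a :=
  .proj a ∘L T ∘L .single R G a

variable [PartialOrder ι]

theorem IsSupportedOn.diagonalBlock_mul (hS : IsSupportedOn (· ≤ ·) S)
    (hT : IsSupportedOn (· ≤ ·) T) (a : ι) :
    diagonalBlock (S * T) a = diagonalBlock S a * diagonalBlock T a := by
  ext v
  refine hS.apply_congr fun b hb => ?_
  rcases hb.lt_or_eq with hlt | rfl
  · have hTb : T (Pi.single a v) b = 0 :=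
      hT _ b fun c hc => Pi.single_eq_of_ne (hc.trans_lt hlt).ne _
    simpa [hlt.ne] using hTb
  · simp [diagonalBlock]

theorem IsSupportedOn.isIdempotentElem_diagonalBlock (hT : IsSupportedOn (· ≤ ·) T)
    (hTT : IsIdempotentElem T) (a : ι) : IsIdempotentElem (diagonalBlock T a) :=
  (hT.diagonalBlock_mul hT a).symm.trans (by rw [hTT.eq])

end Diagonal

variable [∀ a, IsTopologicalAddGroup (G a)]

namespace IsSupportedOn

theorem sub (hS : IsSupportedOn r S) (hT : IsSupportedOn r T) : IsSupportedOn r (S - T) :=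
  fun x a hx => by rw [sub_apply, Pi.sub_apply, hS x a hx, hT x a hx, sub_zero]

theorem injective_one_add (hr : WellFounded r) (hT : IsSupportedOn r T) :
    Function.Injective ⇑(1 + T) := by
  refine (injective_iff_map_eq_zero _).2 fun x hx => funext fun a => ?_
  induction a using hr.induction with
  | _ a ih => simpa [hT x a ih] using congrFun hx a

open scoped Classical in
theorem exists_one_add_mul_eq_one (hr : WellFounded r) (hT : IsSupportedOn r T) :
    ∃ S, (1 + T) * S = 1 := by
  let solve : (a : ι) → (∀ a, G a) →L[R] G a := hr.fix fun a solveBelow =>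
    .proj a - .proj a ∘L T ∘L .pi fun b => if h : r b a then solveBelow b h else 0
  have solve_apply (y : ∀ a, G a) (a : ι) : solve a y = y a - T (fun b => solve b y) a := by
    have below : ∀ b, r b a → (if r b a then solve b else 0) y = solve b y :=
      fun b hb => by rw [if_pos hb]
    rw [← hT.apply_congr below]
    conv_lhs => rw [show solve a = _ from hr.fix_eq _ a]
    rfl
  refine ⟨.pi solve, ContinuousLinearMap.ext fun y => funext fun a => ?_⟩
  exact (congrArg (· + T (fun b => solve b y) a) (solve_apply y a)).trans (sub_add_cancel _ _)

theorem isUnit_one_add (hr : WellFounded r) (hT : IsSupportedOn r T) : IsUnit (1 + T) := by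
  obtain ⟨S, hS⟩ := hT.exists_one_add_mul_eq_one hr
  refine isUnit_iff_exists.2 ⟨S, hS, ContinuousLinearMap.ext fun x =>
    hT.injective_one_add hr ?_⟩
  exact congr($hS ((1 + T) x))

end IsSupportedOn

theorem IsSupportedOn.sub_piMap_diagonalBlock [DecidableEq ι] [PartialOrder ι]
    (hT : IsSupportedOn (· ≤ ·) T) :
    IsSupportedOn (· < ·) (T - .piMap (diagonalBlock T)) := by
  intro x a hx
  refine sub_eq_zero.2 (hT.apply_congr fun b hb => ?_)
  rcases hb.lt_or_eq with hlt | rfl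
  · simp [hx b hlt, hlt.ne]
  · simp

-- The intertwiner is `q * p + (1 - q) * (1 - p)`, written so that it is visibly a strictly
-- triangular perturbation of `1` when `q` is the diagonal of a triangular `p`.
theorem semiconjBy_one_add_of_isIdempotentElem {A : Type*} [Ring A] {p q : A}
    (hp : IsIdempotentElem p) (hq : IsIdempotentElem q) :
    SemiconjBy (1 + (q - (1 - q)) * (p - q)) p q := by
  have hqq (x : A) : q * (q * x) = q * x := by rw [← mul_assoc, hq.eq]
  simp only [SemiconjBy, add_mul, mul_add, sub_mul, mul_sub, one_mul, mul_one, mul_assoc, hp.eq,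
    hq.eq, hqq]
  abel

theorem IsSupportedOn.exists_semiconjBy_piMap_diagonalBlock [DecidableEq ι] [PartialOrder ι]
    [WellFoundedLT ι] (hT : IsSupportedOn (· ≤ ·) T) (hTT : IsIdempotentElem T) :
    ∃ U : ((∀ a, G a) →L[R] (∀ a, G a))ˣ, SemiconjBy ↑U T (.piMap (diagonalBlock T)) := by
  set D : (∀ a, G a) →L[R] (∀ a, G a) := .piMap (diagonalBlock T)
  have hDD : IsIdempotentElem D := ContinuousLinearMap.ext fun x => funext fun a =>
    congr($(hT.isIdempotentElem_diagonalBlock hTT a) (x a))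
  have hD : IsSupportedOn (· = ·) D := isSupportedOn_piMap _
  have hone : IsSupportedOn (· = ·) (1 : (∀ a, G a) →L[R] (∀ a, G a)) := fun x a hx => hx a rfl
  have hlt : IsSupportedOn (· < ·) ((D - (1 - D)) * (T - D)) :=
    (hD.sub (hone.sub hD)).mul hT.sub_piMap_diagonalBlock fun a b c hb hc => hb ▸ hc
  exact ⟨(hlt.isUnit_one_add wellFounded_lt).unit,
    semiconjBy_one_add_of_isIdempotentElem hTT hDD⟩

end BlockOperators

section Retracts

variable {R X X' Y : Type*} [Ring R] [AddCommGroup X] [Module R X] [TopologicalSpace X]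
  [AddCommGroup X'] [Module R X'] [TopologicalSpace X'] [AddCommGroup Y] [Module R Y]
  [TopologicalSpace Y]

theorem nonempty_equiv_of_semiconjBy_leftInverse {s : X →L[R] Y} {r : Y →L[R] X}
    {s' : X' →L[R] Y} {r' : Y →L[R] X'} (hrs : Function.LeftInverse r s)
    (hrs' : Function.LeftInverse r' s') (U : (Y →L[R] Y)ˣ)
    (hU : SemiconjBy ↑U (s ∘L r) (s' ∘L r')) : Nonempty (X ≃L[R] X') := by
  have hUx (y : Y) : U.1 (s (r y)) = s' (r' (U.1 y)) := congr($hU y)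
  have hUinv (y : Y) : U⁻¹.1 (s' (r' y)) = s (r (U⁻¹.1 y)) := congr($(hU.units_inv_symm_left) y)
  have inv_apply (y : Y) : U⁻¹.1 (U.1 y) = y := congr($(U.inv_mul) y)
  have apply_inv (y : Y) : U.1 (U⁻¹.1 y) = y := congr($(U.mul_inv) y)
  exact ⟨.equivOfInverse (r' ∘L U.1 ∘L s) (r ∘L U⁻¹.1 ∘L s')
    (fun x => by simp [hUinv, inv_apply, hrs x])
    (fun x => by simp [hUx, apply_inv, hrs' x])⟩

theorem leftInverse_codRestrict_range_of_isIdempotentElem {T : Y →L[R] Y}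
    (hT : IsIdempotentElem T) :
    Function.LeftInverse (T.codRestrict T.range fun v => ⟨v, rfl⟩) T.range.subtypeL := by
  rintro ⟨_, v, rfl⟩
  exact Subtype.ext congr($hT v)

theorem closedComplemented_range_of_isIdempotentElem {T : Y →L[R] Y} (hT : IsIdempotentElem T) :
    T.range.ClosedComplemented :=
  ⟨_, leftInverse_codRestrict_range_of_isIdempotentElem hT⟩

theorem isIdempotentElem_comp_of_leftInverse {s : X →L[R] Y} {r : Y →L[R] X}
    (hrs : Function.LeftInverse r s) : IsIdempotentElem (s ∘L r) :=
  ContinuousLinearMap.ext fun y => congrArg s (hrs (r y))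

theorem exists_closedComplemented_equiv {f : X →L[R] Y} (hf : f.HasLeftInverse) :
    ∃ F : Submodule R Y, F.ClosedComplemented ∧ Nonempty (X ≃L[R] F) := by
  refine ⟨f.range, hf.closedComplemented_range, ?_⟩
  obtain ⟨g, hg⟩ := hf
  refine ⟨.equivOfInverse (f.codRestrict f.range fun x => ⟨x, rfl⟩) (g ∘L f.range.subtypeL) hg ?_⟩
  rintro ⟨_, x, rfl⟩
  exact Subtype.ext (congrArg f (hg x))

theorem hasLeftInverse_compRightL {ι κ : Type*} {E : ι → Type*} [∀ i, AddCommGroup (E i)]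
    [∀ i, Module R (E i)] [∀ i, TopologicalSpace (E i)] {e : κ → ι} (he : Function.Surjective e) :
    (Pi.compRightL R E e).HasLeftInverse := by
  have coordinate (i : ι) :
      ∃ g : (∀ k, E (e k)) →L[R] E i, ∀ x, g (Pi.compRightL R E e x) = x i := by
    obtain ⟨k, rfl⟩ := he i
    exact ⟨.proj k, fun x => rfl⟩
  choose g hg using coordinate
  exact ⟨.pi g, fun x => funext fun i => hg i x⟩

end Retracts

section Triangular

variable {R X ι : Type*} {G : ι → Type*} [Ring R] [AddCommGroup X] [Module R X]
  [TopologicalSpace X] [∀ a, AddCommGroup (G a)] [∀ a, Module R (G a)]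
  [∀ a, TopologicalSpace (G a)] [∀ a, IsTopologicalAddGroup (G a)] [DecidableEq ι] [PartialOrder ι]
  [WellFoundedLT ι]

theorem IsSupportedOn.nonempty_equiv_pi_range_diagonalBlock {s : X →L[R] ∀ a, G a}
    {r : (∀ a, G a) →L[R] X} (hrs : Function.LeftInverse r s)
    (h : IsSupportedOn (· ≤ ·) (s ∘L r)) :
    Nonempty (X ≃L[R] ∀ a, (diagonalBlock (s ∘L r) a).range) := by
  have hsr : IsIdempotentElem (s ∘L r) := isIdempotentElem_comp_of_leftInverse hrs
  obtain ⟨U, hU⟩ := h.exists_semiconjBy_piMap_diagonalBlock hsr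
  refine nonempty_equiv_of_semiconjBy_leftInverse
    (s' := .piMap fun a => (diagonalBlock (s ∘L r) a).range.subtypeL)
    (r' := .piMap fun a => (diagonalBlock (s ∘L r) a).codRestrict _ fun v => ⟨v, rfl⟩) hrs ?_ U hU
  exact fun y => funext fun a => leftInverse_codRestrict_range_of_isIdempotentElem
    (h.isIdempotentElem_diagonalBlock hsr a) (y a)

end Triangular

theorem countable_setOf_reflTransGen {α : Type*} {r : α → α → Prop}
    (hr : ∀ a, {b | r b a}.Countable) (a : α) :
    {b | Relation.ReflTransGen r b a}.Countable := by
  let predecessors (s : Set α) : Set α := ⋃ b ∈ s, {c | r c b}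
  have hcount (n : ℕ) : (predecessors^[n] {a}).Countable := by
    induction n with
    | zero => exact Set.countable_singleton a
    | succ n ih =>
      rw [Function.iterate_succ_apply']
      exact ih.biUnion fun b _ => hr b
  refine (Set.countable_iUnion hcount).mono fun b hb => Set.mem_iUnion.2 ?_
  induction hb using Relation.ReflTransGen.head_induction_on with
  | refl => exact ⟨0, rfl⟩
  | head hcb _ ih =>
    obtain ⟨n, hn⟩ := ih
    refine ⟨n + 1, ?_⟩
    rw [Function.iterate_succ_apply']
    exact Set.mem_biUnion hn hcb

theorem exists_rank_countable_fiber {α : Type*} [LinearOrder α] [WellFoundedLT α]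
    {r : α → α → Prop} (hr : ∀ a, {b | r b a}.Countable) :
    ∃ ρ : α → α, (∀ a, (ρ ⁻¹' {a}).Countable) ∧ ∀ a b, r b a → ρ b ≤ ρ a := by
  have self_mem (b : α) : {a | Relation.ReflTransGen r b a}.Nonempty := ⟨b, .refl⟩
  let ρ (b : α) : α := wellFounded_lt.min _ (self_mem b)
  have reach_rank (b : α) : Relation.ReflTransGen r b (ρ b) :=
    wellFounded_lt.min_mem _ (self_mem b)
  refine ⟨ρ, fun a => (countable_setOf_reflTransGen hr a).mono ?_, fun a b hba => ?_⟩
  · rintro b rfl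
    exact reach_rank b
  · exact wellFounded_lt.min_le (.head hba (reach_rank a))

/-- Grouping the factors of a product along the fibres of a map `ρ` of the index set. -/
def piFiberEquiv (R : Type*) [Ring R] {I ι : Type*} (E : I → Type*) [∀ i, AddCommGroup (E i)]
    [∀ i, Module R (E i)] [∀ i, TopologicalSpace (E i)] (ρ : I → ι) :
    (∀ i, E i) ≃L[R] ∀ a, ∀ i : ρ ⁻¹' {a}, E i :=
  .equivOfInverse (.pi fun a => Pi.compRightL R E (Subtype.val : ρ ⁻¹' {a} → I))
    (.pi fun i => .proj (⟨i, rfl⟩ : ρ ⁻¹' {ρ i}) ∘L .proj (ρ i)) (fun _ => rfl)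
    fun y => by ext a ⟨i, rfl⟩; rfl

section NormedFactors

variable {𝕜 I : Type*} {E : I → Type*} [NontriviallyNormedField 𝕜]

theorem exists_finset_forall_apply_eq_zero [∀ i, AddCommGroup (E i)] [∀ i, Module 𝕜 (E i)]
    [∀ i, TopologicalSpace (E i)] {F : Type*} [NormedAddCommGroup F] [NormedSpace 𝕜 F]
    (f : (∀ i, E i) →L[𝕜] F) : ∃ N : Finset I, ∀ x, (∀ i ∈ N, x i = 0) → f x = 0 := by
  have hball : f ⁻¹' Metric.ball 0 1 ∈ 𝓝 (0 : ∀ i, E i) :=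
    f.continuous.continuousAt.preimage_mem_nhds (by simpa using Metric.ball_mem_nhds 0 one_pos)
  rw [nhds_pi, Filter.mem_pi] at hball
  obtain ⟨N, hN, t, ht, hsub⟩ := hball
  refine ⟨hN.toFinset, fun x hx => ?_⟩
  have hbounded (c : 𝕜) : ‖c‖ * ‖f x‖ < 1 := by
    have hc : c • x ∈ N.pi t := fun i hi => by
      simpa [hx i (hN.mem_toFinset.2 hi)] using mem_of_mem_nhds (ht i)
    simpa [norm_smul] using hsub hc
  by_contra hne
  obtain ⟨c, hc⟩ := NormedField.exists_lt_norm 𝕜 ‖f x‖⁻¹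
  exact (hbounded c).not_gt ((inv_lt_iff_one_lt_mul₀ (norm_pos_iff.2 hne)).1 hc)

variable [∀ i, NormedAddCommGroup (E i)] [∀ i, NormedSpace 𝕜 (E i)]
  {X : Type*} [AddCommGroup X] [Module 𝕜 X] [TopologicalSpace X]

theorem exists_isSupportedOn_countable (T : (∀ i, E i) →L[𝕜] (∀ i, E i)) :
    ∃ r : I → I → Prop, (∀ i, {j | r j i}.Countable) ∧ IsSupportedOn r T := by
  choose N hN using fun i => exists_finset_forall_apply_eq_zero (.proj i ∘L T)
  exact ⟨fun j i => j ∈ N i, fun i => (N i).countable_toSet, fun x i hx => hN i x hx⟩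

theorem exists_equiv_pi_closedComplemented_countable {s : X →L[𝕜] ∀ i, E i}
    (hs : s.HasLeftInverse) :
    ∃ (ρ : I → I) (F : ∀ a, Submodule 𝕜 (∀ i : ρ ⁻¹' {a}, E i)),
      (∀ a, (ρ ⁻¹' {a}).Countable) ∧ (∀ a, (F a).ClosedComplemented) ∧
        Nonempty (X ≃L[𝕜] ∀ a, F a) := by
  obtain ⟨r, hrs⟩ := hs
  obtain ⟨rel, hrel, hsupp⟩ := exists_isSupportedOn_countable (s ∘L r)
  obtain ⟨_, _⟩ := exists_wellFoundedLT I
  obtain ⟨ρ, hρ, hmono⟩ := exists_rank_countable_fiber hrel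
  let e := piFiberEquiv 𝕜 E ρ
  let s' : X →L[𝕜] ∀ a, ∀ i : ρ ⁻¹' {a}, E i := e.toContinuousLinearMap ∘L s
  let r' : (∀ a, ∀ i : ρ ⁻¹' {a}, E i) →L[𝕜] X := r ∘L e.symm.toContinuousLinearMap
  have hrs' : Function.LeftInverse r' s' := fun x =>
    (congrArg r (e.symm_apply_apply (s x))).trans (hrs x)
  have triangular : IsSupportedOn (· ≤ ·) (s' ∘L r') := by
    refine fun y a hy => funext fun ⟨i, hi⟩ => hsupp _ i fun j hj => ?_
    exact congrFun (hy (ρ j) ((hmono i j hj).trans_eq hi)) ⟨j, rfl⟩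
  have hidem (a : I) : IsIdempotentElem (diagonalBlock (s' ∘L r') a) :=
    triangular.isIdempotentElem_diagonalBlock (isIdempotentElem_comp_of_leftInverse hrs') a
  exact ⟨ρ, _, hρ, fun a => closedComplemented_range_of_isIdempotentElem (hidem a),
    triangular.nonempty_equiv_pi_range_diagonalBlock hrs'⟩

end NormedFactors

section InjectiveSpaces

open scoped ComplexOrder in
theorem polynormableSpace_of_locallyConvexSpace_real {𝕜 X : Type*} [RCLike 𝕜] [AddCommGroup X]
    [Module 𝕜 X] [Module ℝ X] [IsScalarTower ℝ 𝕜 X] [TopologicalSpace X] [IsTopologicalAddGroup X]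
    [ContinuousSMul 𝕜 X] [LocallyConvexSpace ℝ X] : PolynormableSpace 𝕜 X := by
  have : ContinuousSMul ℝ X := IsScalarTower.continuousSMul 𝕜
  have : LocallyConvexSpace 𝕜 X := .ofBases 𝕜 X (fun _ => id) _ LocallyConvexSpace.convex_basis
    fun _ _ hs => convex_of_nonneg_surjective_algebraMap _
      (fun _ => RCLike.nonneg_iff_exists_ofReal.1) hs.2
  exact LocallyConvexSpace.toPolynormableSpace

variable {X : Type u} [AddCommGroup X] [Module ℂ X] [TopologicalSpace X]

theorem exists_continuousLinearMap_ellInfty [IsTopologicalAddGroup X] {q : Seminorm ℂ X}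
    (hq : Continuous q) {J : Type*} (g : J → Module.Dual ℂ X) (hg : ∀ j x, ‖g j x‖ ≤ q x) :
    ∃ G : X →L[ℂ] EllInfty J, ∀ x j, (G x : J → ℂ) j = g j x := by
  let G : X →ₗ[ℂ] EllInfty J :=
    { toFun x := ⟨fun j => g j x, memℓp_infty ⟨q x, by rintro _ ⟨j, rfl⟩; exact hg j x⟩⟩
      map_add' x y := by ext j; exact map_add (g j) x y
      map_smul' c x := by ext j; exact map_smul (g j) c x }
  have hGq (x : X) : ‖G x‖ ≤ q x := lp.norm_le_of_forall_le (apply_nonneg q x) fun j => hg j x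
  have hG : Continuous G := (norm_withSeminorms ℂ _).continuous_of_continuous_comp G fun _ =>
    Seminorm.continuous_of_le hq hGq
  exact ⟨⟨G, hG⟩, fun x j => rfl⟩

theorem isInjectiveLCS_ellInfty (J : Type u) : IsInjectiveLCS (EllInfty J) := by
  intro B _ _ _ _ _ _ _ A f
  have : PolynormableSpace ℂ B := polynormableSpace_of_locallyConvexSpace_real
  obtain ⟨q, hq, hle⟩ := Seminorm.exists_le_comp_of_isInducing (f := A.subtype)
    (p := (normSeminorm ℂ (EllInfty J)).comp f.toLinearMap) f.continuous.norm
    IsInducing.subtypeVal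
  let coordinate (j : J) : Module.Dual ℂ A := (lp.evalCLM ℂ _ ∞ j ∘L f).toLinearMap
  have hcoordinate (j : J) (a : A) : ‖coordinate j a‖ ≤ q a :=
    (lp.norm_apply_le_norm ENNReal.top_ne_zero (f a) j).trans (hle a)
  choose g hg hgq using fun j =>
    Module.Dual.exists_extension_of_le_seminorm A (coordinate j) (hcoordinate j)
  obtain ⟨G, hG⟩ := exists_continuousLinearMap_ellInfty hq g hgq
  exact ⟨G, fun a => lp.ext (funext fun j => (hG a j).trans (hg j a))⟩

theorem exists_dual_apply_eq_seminorm {𝕜 E : Type*} [RCLike 𝕜] [AddCommGroup E] [Module 𝕜 E]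
    (p : Seminorm 𝕜 E) (x : E) :
    ∃ g : Module.Dual 𝕜 E, g x = p x ∧ ∀ y, ‖g y‖ ≤ p y := by
  rcases eq_or_ne x 0 with rfl | hx
  · exact ⟨0, by simp, fun y => by simp⟩
  have hp (y : 𝕜 ∙ x) :
      ‖((p x : 𝕜) • (LinearEquiv.coord 𝕜 E x hx).toLinearMap) y‖ ≤ p y := by
    have hy : p y = ‖LinearEquiv.coord 𝕜 E x hx y‖ * p x := by
      rw [← map_smul_eq_mul, LinearEquiv.coord_apply_smul]
    simp [hy, mul_comm, norm_smul, abs_of_nonneg (apply_nonneg p x)]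
  obtain ⟨g, hg, hgp⟩ := Module.Dual.exists_extension_of_le_seminorm (𝕜 ∙ x) _ hp
  refine ⟨g, (hg ⟨x, Submodule.mem_span_singleton_self x⟩).trans ?_, hgp⟩
  simp [LinearEquiv.coord_self, Algebra.smul_def]

theorem exists_norm_ellInfty_eq_seminorm [IsTopologicalAddGroup X] {p : Seminorm ℂ X}
    (hp : Continuous p) : ∃ f : X →L[ℂ] EllInfty X, ∀ x, ‖f x‖ = p x := by
  choose g hg hgp using exists_dual_apply_eq_seminorm p
  obtain ⟨f, hf⟩ := exists_continuousLinearMap_ellInfty hp g hgp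
  refine ⟨f, fun x => le_antisymm ?_ ?_⟩
  · exact lp.norm_le_of_forall_le (apply_nonneg p x) fun y => (hf x y).symm ▸ hgp y x
  · calc p x = ‖(f x : X → ℂ) x‖ := by simp [hf, hg, abs_of_nonneg (apply_nonneg p x)]
      _ ≤ ‖f x‖ := lp.norm_apply_le_norm ENNReal.top_ne_zero (f x) x

theorem exists_isEmbedding_pi_ellInfty [PolynormableSpace ℂ X] [T2Space X] :
    ∃ (I : Type u) (J : I → Type u) (f : X →L[ℂ] ∀ i, EllInfty (J i)),
      IsEmbedding f := by
  have hX := PolynormableSpace.withSeminorms ℂ X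
  have := hX.topologicalAddGroup
  choose f hf using fun p : {p : Seminorm ℂ X // Continuous p} =>
    exists_norm_ellInfty_eq_seminorm p.2
  have hinducing : IsInducing (ContinuousLinearMap.pi f) := by
    refine IsTopologicalAddGroup.isInducing_iff_nhds_zero.2 ?_
    calc 𝓝 0 = ⨅ p : {p : Seminorm ℂ X // Continuous p}, (𝓝 0).comap p.1 :=
          (SeminormFamily.withSeminorms_iff_nhds_eq_iInf _).1 hX
      _ = ⨅ p, (𝓝 0).comap (f p) := iInf_congr fun p => by
          rw [← comap_norm_nhds_zero (E := EllInfty X), Filter.comap_comap]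
          exact congrArg (Filter.comap · (𝓝 0)) (funext fun x => (hf p x).symm)
      _ = (𝓝 0).comap (ContinuousLinearMap.pi f) := by
          simp only [nhds_pi, Filter.pi, Filter.comap_iInf, Filter.comap_comap]
          rfl
  exact ⟨_, _, .pi f, hinducing.isEmbedding⟩

theorem IsInjectiveLCS.hasLeftInverse_of_isEmbedding (hX : IsInjectiveLCS X) {Y : Type u}
    [AddCommGroup Y] [Module ℂ Y] [TopologicalSpace Y] [PolynormableSpace ℂ Y] [T2Space Y]
    {f : X →L[ℂ] Y} (hf : IsEmbedding f) : f.HasLeftInverse := by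
  have hY := PolynormableSpace.withSeminorms ℂ Y
  have := hY.topologicalAddGroup
  have := hY.continuousSMul
  have : LocallyConvexSpace ℝ Y := hY.toLocallyConvexSpace
  let e : X ≃ₗ[ℂ] f.range := LinearEquiv.ofInjective f.toLinearMap hf.injective
  have he : Continuous e.symm := hf.isInducing.continuous_iff.2 <|
    continuous_subtype_val.congr fun y => congrArg Subtype.val (e.apply_symm_apply y).symm
  obtain ⟨g, hg⟩ := hX Y f.range ⟨e.symm.toLinearMap, he⟩
  exact ⟨g, fun x => (hg (e x)).trans (e.symm_apply_apply x)⟩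

theorem IsInjectiveLCS.exists_hasLeftInverse_pi_ellInfty [PolynormableSpace ℂ X] [T2Space X]
    (hX : IsInjectiveLCS X) :
    ∃ (I : Type u) (J : I → Type u) (s : X →L[ℂ] ∀ i, EllInfty (J i)), s.HasLeftInverse := by
  obtain ⟨I, J, s, hs⟩ := exists_isEmbedding_pi_ellInfty (X := X)
  exact ⟨I, J, s, hX.hasLeftInverse_of_isEmbedding hs⟩

theorem IsInjectiveLCS.of_hasLeftInverse_pi {I : Type*} {E : I → Type u}
    [∀ i, AddCommGroup (E i)] [∀ i, Module ℂ (E i)] [∀ i, TopologicalSpace (E i)]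
    (hE : ∀ i, IsInjectiveLCS (E i)) {s : X →L[ℂ] ∀ i, E i} (hs : s.HasLeftInverse) :
    IsInjectiveLCS X := by
  intro B _ _ _ _ _ _ _ A f
  obtain ⟨r, hr⟩ := hs
  choose g hg using fun i => hE i B A (.proj i ∘L s ∘L f)
  refine ⟨r ∘L .pi g, fun a => ?_⟩
  have hga : ContinuousLinearMap.pi g (a : B) = s (f a) := funext fun i => hg i a
  exact (congrArg r hga).trans (hr (f a))

end InjectiveSpaces

theorem exists_hasLeftInverse_pi_nat_ellInfty {D : Type*} [Countable D] (J : D → Type u) :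
    ∃ (J' : ℕ → Type u) (f : (∀ d, EllInfty (J d)) →L[ℂ] ∀ n, EllInfty (J' n)),
      f.HasLeftInverse := by
  rcases isEmpty_or_nonempty D with _ | _
  · exact ⟨fun _ => PEmpty, 0, 0, fun x => Subsingleton.elim _ _⟩
  · obtain ⟨e, he⟩ := exists_surjective_nat D
    exact ⟨J ∘ e, Pi.compRightL ℂ (fun d => EllInfty (J d)) e, hasLeftInverse_compRightL he⟩

theorem theoremT (X : Type u) [AddCommGroup X] [Module ℂ X] [TopologicalSpace X]
    [IsTopologicalAddGroup X] [ContinuousSMul ℂ X] [LocallyConvexSpace ℝ X] [T2Space X] :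
    IsInjectiveLCS X ↔
      ∃ (T : Type u) (J : T → ℕ → Type u) (F : ∀ t : T, Submodule ℂ (∀ n : ℕ, EllInfty (J t n))),
        (∀ t : T, (F t).ClosedComplemented) ∧ Nonempty (X ≃L[ℂ] (∀ t : T, F t)) := by
  constructor
  · intro hX
    have : PolynormableSpace ℂ X := polynormableSpace_of_locallyConvexSpace_real
    obtain ⟨I, J, s, hs⟩ := hX.exists_hasLeftInverse_pi_ellInfty
    obtain ⟨ρ, K, hρ, hK, ⟨e⟩⟩ := exists_equiv_pi_closedComplemented_countable hs
    have hfactor (a : I) : ∃ (J' : ℕ → Type u) (F : Submodule ℂ (∀ n, EllInfty (J' n))),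
        F.ClosedComplemented ∧ Nonempty (K a ≃L[ℂ] F) := by
      have := (hρ a).to_subtype
      obtain ⟨J', f, hf⟩ := exists_hasLeftInverse_pi_nat_ellInfty fun i : ρ ⁻¹' {a} => J i
      have hsubtype : (K a).subtypeL.HasLeftInverse := hK a
      exact ⟨J', exists_closedComplemented_equiv (hf.comp hsubtype)⟩
    choose J' F hF g using hfactor
    exact ⟨I, J', F, hF, ⟨e.trans (.piCongrRight fun a => (g a).some)⟩⟩
  · rintro ⟨T, J, F, hF, ⟨e⟩⟩
    refine .of_hasLeftInverse_pi (fun t => ?_) e.hasLeftInverse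
    have hsubtype : (F t).subtypeL.HasLeftInverse := hF t
    exact .of_hasLeftInverse_pi (fun n => isInjectiveLCS_ellInfty (J t n)) hsubtype
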